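/- Let $\mathcal T$ be a plumbing tree with finite vertex set $\mathcal V$, all genus decorations zero, whose associated intersection form $(\,,\,)$ is negative definite. Let $\delta_v$ be the valency of $v\in\mathcal V$, let $L=\mathbb Z\langle E_v\rangle_{v\in\mathcal V}$ be the lattice with form $(\,,\,)$, where $(E_v,E_v)$ is the Euler number of $v$ and, for $v\neq w$, $(E_v,E_w)$ is $1$ if $v,w$ are adjacent and $0$ otherwise. Let $L'=\{l'\in L\otimes\mathbb Q : (l',L)\subset\mathbb Z\}$ be the dual lattice, $H=L'/L$, and write $[l']\in H$ for the class of $l'\in L'$ and $l'|_v$ for the $E_v$-coefficient of $l'$. Let $E_v^*\in L'$ be defined by $(E_v^*,E_w)=-1$ if $v=w$ and $0$ otherwise, and let $\mathcal S'=\mathbb Z_{\ge 0}\langle E_v^*\rangle_{v\in\mathcal V}$. With $\mathbf t^{l'}=\prod_v t_v^{l'|_v}$, let $z(l')$ be the coefficient of $\mathbf t^{l'}$ in the Taylor expansion at the origin of $\prod_{v\in\mathcal V}(1-\mathbf t^{E_v^*})^{\delta_v-2}$. For $h\in H$, a non-empty $\mathcal J\subset\mathcal V$ and $x\in L'$ with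 $[x]=h$, define the modified counting function $$q_{h,\mathcal J}(x)=\sum_{l'\in L',\ [l']=h,\ l'|_v<x|_v\ \forall v\in\mathcal J} z(l').$$ Let $\emptyset\ne\mathcal I\subset\mathcal V$ and let $\overline{\mathcal I}$ be the vertex set of the minimal connected full subgraph of $\mathcal T$ containing $\mathcal I$. Let $h\in H$ and let $l'_0\in \sum_{v}(\delta_v-2)E_v^*+\mathcal S'$ with $[l'_0]=h$. Then the sums defining $q_{h,\mathcal I}(l'_0)$ and $q_{h,\overline{\mathcal I}}(l'_0)$ have only finitely many non-zero terms, and $$q_{h,\mathcal I}(l'_0)=q_{h,\overline{\mathcal I}}(l'_0).$$ -/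

import Mathlib

/-- A plumbing graph: a (simple) graph on the vertex set `V` whose vertices are decorated by
Euler numbers (the self-intersections `(E_v, E_v)`).  Only trees with all genus decorations
zero are considered, so there are no multiple edges and the genera are not recorded. -/
structure PlumbingGraph (V : Type*) where
  graph : SimpleGraph V
  euler : V → ℤ

namespace PlumbingGraph

variable {V : Type*} [Fintype V] [DecidableEq V] (T : PlumbingGraph V)

open Classical in
/-- The intersection matrix: `(E_v, E_v)` is the Euler number of `v`, and for `v ≠ w`
`(E_v, E_w)` is `1` if `v` and `w` are adjacent and `0` otherwise. -/
noncomputable def intersectionMatrix : Matrix V V ℤ :=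
  Matrix.of fun v w => if v = w then T.euler v else if T.graph.Adj v w then 1 else 0

/-- The intersection form on `L ⊗ ℚ`, which is identified with `V → ℚ`
by means of the basis `E_v`. -/
noncomputable def form : LinearMap.BilinForm ℚ (V → ℚ) :=
  Matrix.toBilin' (T.intersectionMatrix.map (Int.cast : ℤ → ℚ))

/-- The intersection form is negative definite. -/
def IsNegDef : Prop := ∀ x : V → ℚ, x ≠ 0 → T.form x x < 0

open Classical in
/-- The valency `δ_v`. -/
noncomputable def valency (v : V) : ℕ := T.graph.degree v

/-- The base element `E_v`, as an element of `L ⊗ ℚ`. -/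
def E (_T : PlumbingGraph V) (v : V) : V → ℚ := Pi.single v 1

/-- The lattice `L`, freely generated by the `E_v`, inside `L ⊗ ℚ`. -/
def latticeL : Submodule ℤ (V → ℚ) := Submodule.span ℤ (Set.range T.E)

/-- The dual lattice `L' = {l' ∈ L ⊗ ℚ : (l', L) ⊆ ℤ}`. -/
noncomputable def latticeL' : Submodule ℤ (V → ℚ) := T.form.dualSubmodule T.latticeL

/-- The group `H = L' / L`. -/
noncomputable abbrev H : Type _ := T.latticeL' ⧸ T.latticeL.submoduleOf T.latticeL'

/-- The class `[x] ∈ H` of `x ∈ L'`. -/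
noncomputable def cls (x : T.latticeL') : T.H := Submodule.Quotient.mk x

/-- The (anti)dual class `E*_v`: its coordinates are the entries of the `v`-th column of minus
the inverse of the intersection matrix, so that `(E*_v, E_w) = -δ_{vw}`, see `form_Estar_E`. -/
noncomputable def Estar (v : V) : V → ℚ :=
  fun w => -(T.intersectionMatrix.map (Int.cast : ℤ → ℚ))⁻¹ w v

/-- The Lipman cone `S' = ℤ_{≥ 0}⟨E*_v⟩`. -/
noncomputable def lipmanCone : AddSubmonoid (V → ℚ) := AddSubmonoid.closure (Set.range T.Estar)

/-- The formal power series `1 - X_v`, as an invertible power series. -/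
noncomputable def oneSubX (v : V) : (MvPowerSeries V ℤ)ˣ :=
  IsUnit.unit (a := 1 - MvPowerSeries.X v) (by
    rw [MvPowerSeries.isUnit_iff_constantCoeff]; simp)

/-- The Taylor expansion of `∏ v, (1 - X_v) ^ (δ_v - 2)` in the variables `X_v = t ^ (E*_v)`;
the exponents `δ_v - 2` are integers, possibly negative. -/
noncomputable def poincareSeries : MvPowerSeries V ℤ :=
  ((∏ v : V, oneSubX v ^ ((T.valency v : ℤ) - 2) : (MvPowerSeries V ℤ)ˣ) : MvPowerSeries V ℤ)

/-- The coefficient `z(l')` of `t ^ l'` in the Taylor expansion `Z(t)` of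
`∏ v, (1 - t ^ (E*_v)) ^ (δ_v - 2)`: the monomial `∏ v, X_v ^ (b_v)` of `poincareSeries` is
`t ^ l'` with `l' = ∑ v, b_v E*_v`.  As the `E*_v` are linearly independent, at most one `b`
occurs in the sum. -/
noncomputable def z (l' : V → ℚ) : ℤ :=
  ∑ᶠ (b : V →₀ ℕ) (_ : ∑ v, b v • T.Estar v = l'), MvPowerSeries.coeff b T.poincareSeries

/-- The elements `l' ∈ L'` with `[l'] = h` and `l'|_J ≺ x|_J`, i.e. `l'_v < x_v` for all
`v ∈ J`. -/
def modifiedRegion (h : T.H) (J : Set V) (x : T.latticeL') : Set T.latticeL' :=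
  {l' | T.cls l' = h ∧ ∀ v ∈ J, (l' : V → ℚ) v < (x : V → ℚ) v}

/-- The modified counting function `q_{h,J}(x)`: the sum of the coefficients `z(l')` over all
`l' ∈ L'` with `[l'] = h` and `l'|_J ≺ x|_J`. -/
noncomputable def q (h : T.H) (J : Set V) (x : T.latticeL') : ℤ :=
  ∑ᶠ l' ∈ T.modifiedRegion h J x, T.z (l' : V → ℚ)

/-- `K` is the closure of `I`: the vertex set of a minimal connected full subgraph that
contains `I`. -/
def IsClosure (T : PlumbingGraph V) (I K : Set V) : Prop :=
  Minimal (fun S : Set V => I ⊆ S ∧ (T.graph.induce S).Connected) K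

theorem det_ne_zero (hT : T.IsNegDef) :
    (T.intersectionMatrix.map (Int.cast : ℤ → ℚ)).det ≠ 0 := by
  intro h
  obtain ⟨x, hx, hx0⟩ := Matrix.exists_mulVec_eq_zero_iff.2 h
  have := hT x hx
  simp [form, Matrix.toBilin'_apply', hx0] at this

theorem form_Estar_E (hT : T.IsNegDef) (v w : V) :
    T.form (T.Estar v) (T.E w) = if v = w then -1 else 0 := by
  have hsymm : (T.intersectionMatrix.map (Int.cast : ℤ → ℚ)).transpose =
      T.intersectionMatrix.map (Int.cast : ℤ → ℚ) := by
    ext i j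
    simp only [Matrix.transpose_apply, Matrix.map_apply, intersectionMatrix, Matrix.of_apply]
    by_cases hij : i = j
    · subst hij; rfl
    · by_cases ha : T.graph.Adj i j
      · simp [hij, Ne.symm hij, ha, ha.symm]
      · simp [hij, Ne.symm hij, ha, mt SimpleGraph.Adj.symm ha]
  have h1 := Matrix.mul_nonsing_inv (T.intersectionMatrix.map (Int.cast : ℤ → ℚ))
    (isUnit_iff_ne_zero.2 (T.det_ne_zero hT))
  have h2 := congrFun (congrFun h1 w) v
  rw [Matrix.mul_apply, Matrix.one_apply] at h2
  have h3 : T.form (T.Estar v) (T.E w) = -∑ j,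
      (T.intersectionMatrix.map (Int.cast : ℤ → ℚ)) w j *
      (T.intersectionMatrix.map (Int.cast : ℤ → ℚ))⁻¹ j v := by
    rw [form, Matrix.toBilin'_apply', E, Matrix.mulVec_single_one, dotProduct,
      ← Finset.sum_neg_distrib]
    refine Finset.sum_congr rfl fun j _ => ?_
    have := congrFun (congrFun hsymm w) j
    simp only [Matrix.transpose_apply] at this
    simp only [Estar, Matrix.col_apply, this]
    ring
  rw [h3, h2]
  by_cases hvw : v = w
  · simp [hvw]
  · simp [hvw, Ne.symm hvw]

end PlumbingGraph

/-! Write `l' = l'_0 + m` with `m` an integer vector, `e_v` for the Euler number and `β_v = -(l'_0,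
E_v)`. Then `z(l')` is the product over `v` of the coefficients of `(1 - X)^(δ_v - 2)` in degree
`β_v - e_v m_v - ∑_{y ~ v} m_y`, and the hypothesis on `l'_0` says `β_v ≥ δ_v - 2`. The vertices of
the closure are added to `I` one at a time. Adding `w` to `J` discards exactly the terms with `m_v <
0` on `J` and `m_w ≥ 0`, so their sum must vanish (`q_insert_eq`). What makes it vanish is that `w`
separates two elements of `I` (`IsClosure.exists_separation`).

The sum is evaluated by eliminating leaves `u ≠ w`. Each vertex carries Laurent series `Ψ_v(s)`,
indexed by the value `s = m_v`. For a leaf `u` with neighbour `p`, summing over `m_u` is a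
convolution: it replaces `Ψ_p(s)` by `Ψ_p(s) ψ(s)`, where `ψ(s)` has `t`-th coefficient equal to the
coefficient of `Ψ_u(t)` in degree `-s`. The diagonal entry `κ_p` becomes `κ_p - 1/κ_u`, as in
Gaussian elimination, and stays positive by definiteness.

The invariant `IsAdmissible` says that for `s ≥ 0` the series `(1 - X)^(2 - deg v) Ψ_v(s)` is a
Laurent polynomial of controlled degree. Its value at `X = 1` is `1` if `τ_v = 0`, and it vanishes
there to order `τ_v` otherwise. A nonzero `τ` records a sign condition from `J` at the vertex or in
a branch already absorbed by it. The colouring `br` distinguishes two sides of `w`, each meeting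
`J`, so `τ_w ≥ 2` once only `w` is left. Then `(1 - X)^2 Ψ_w(s)` has degree below `2` and a double
zero at `1`; hence `Ψ_w(s)` has negative degree and its constant coefficient is `0`. -/

namespace HahnSeries

/-! ### Laurent series: degree bounds and order of vanishing at `X = 1`. -/

/-- All coefficients of `f` in degrees above `d` vanish. -/
def DegLE (f : HahnSeries ℤ ℤ) (d : ℤ) : Prop := ∀ n, d < n → f.coeff n = 0

/-- The series `1 - X`. -/
noncomputable def oneSub : HahnSeries ℤ ℤ := 1 - single 1 1

theorem oneSub_ne_zero : oneSub ≠ 0 := by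
  intro h
  have := congrArg (fun f : HahnSeries ℤ ℤ => f.coeff 0) h
  simp [oneSub, coeff_single_of_ne] at this

theorem coeff_oneSub_mul (f : HahnSeries ℤ ℤ) (n : ℤ) :
    (oneSub * f).coeff n = f.coeff n - f.coeff (n - 1) := by
  simp [oneSub, sub_mul, coeff_single_mul]

theorem DegLE.mono {f : HahnSeries ℤ ℤ} {d e : ℤ} (hf : f.DegLE d) (h : d ≤ e) : f.DegLE e :=
  fun n hn => hf n (by lia)

theorem DegLE.add {f g : HahnSeries ℤ ℤ} {d : ℤ} (hf : f.DegLE d) (hg : g.DegLE d) :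
    (f + g).DegLE d := fun n hn => by simp [hf n hn, hg n hn]

theorem DegLE.mul {f g : HahnSeries ℤ ℤ} {d e : ℤ} (hf : f.DegLE d) (hg : g.DegLE e) :
    (f * g).DegLE (d + e) := by
  intro n hn
  rw [coeff_mul]
  refine Finset.sum_eq_zero fun ij hij => ?_
  have h := (Finset.mem_antidiagonal.1 hij).2.2
  rcases lt_or_ge d ij.1 with h1 | h1
  · rw [hf _ h1, zero_mul]
  · rw [hg _ (by lia), mul_zero]

theorem degLE_single (d : ℤ) : (single d (1 : ℤ)).DegLE d :=
  fun _ hn => coeff_single_of_ne hn.ne'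

theorem degLE_oneSub : oneSub.DegLE 1 := by
  intro n hn
  simp [oneSub, coeff_one, coeff_single_of_ne hn.ne', (by lia : n ≠ 0)]

theorem degLE_oneSub_pow (k : ℕ) : (oneSub ^ k).DegLE k := by
  induction k with
  | zero => simpa using degLE_single 0
  | succ k ih => rw [pow_succ]; exact_mod_cast ih.mul degLE_oneSub

theorem le_of_coeff_mul_ne_zero {f g : HahnSeries ℤ ℤ} {a b : ℚ}
    (hf : ∀ n, f.coeff n ≠ 0 → a ≤ n) (hg : ∀ n, g.coeff n ≠ 0 → b ≤ n) (n : ℤ)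
    (hn : (f * g).coeff n ≠ 0) : a + b ≤ n := by
  rw [coeff_mul] at hn
  obtain ⟨ij, hij, h0⟩ := Finset.exists_ne_zero_of_sum_ne_zero hn
  have h := (Finset.mem_antidiagonal.1 hij).2.2
  have h1 := hf _ (left_ne_zero_of_mul h0)
  have h2 := hg _ (right_ne_zero_of_mul h0)
  rw [← h]
  push_cast
  linarith

/-- The form of the convolution in which `t` will be the value at an eliminated leaf. -/
theorem coeff_mul_eq_finsum (f g : HahnSeries ℤ ℤ) (n : ℤ) :
    (f * g).coeff n = ∑ᶠ t, g.coeff t * f.coeff (n - t) := by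
  rw [coeff_mul, finsum_eq_sum_of_support_subset (s :=
    (Finset.antidiagonal f.isPWO_support g.isPWO_support n).image Prod.snd)]
  · rw [Finset.sum_image]
    · refine Finset.sum_congr rfl fun ij hij => ?_
      have h := (Finset.mem_antidiagonal.1 hij).2.2
      rw [← h, add_sub_cancel_right, mul_comm]
    · rintro ⟨i, j⟩ hij ⟨i', j'⟩ hij' h
      have h1 := (Finset.mem_antidiagonal.1 hij).2.2
      have h2 := (Finset.mem_antidiagonal.1 hij').2.2
      simp only [Prod.mk.injEq] at *
      lia
  · intro t ht
    simp only [Finset.coe_image, Set.mem_image, Finset.mem_coe]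
    exact ⟨(n - t, t), Finset.mem_antidiagonal.2 ⟨right_ne_zero_of_mul ht, left_ne_zero_of_mul ht, by simp⟩, rfl⟩

/-- `P` behaves like a Laurent polynomial of degree at most `D`, which takes the value `1` at
`X = 1` if `k = 0`, and which vanishes to order at least `k` there if `k ≠ 0`. -/
def VanishingType (k : ℕ) (D : ℤ) (P : HahnSeries ℤ ℤ) : Prop :=
  (k = 0 ∧ ∃ Q : HahnSeries ℤ ℤ, Q.DegLE (D - 1) ∧ P = single D 1 + oneSub * Q) ∨
  (k ≠ 0 ∧ ∃ R : HahnSeries ℤ ℤ, R.DegLE (D - k) ∧ P = oneSub ^ k * R)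

theorem VanishingType.exists_pow_mul {k : ℕ} {D : ℤ} {P : HahnSeries ℤ ℤ}
    (h : VanishingType k D P) : ∃ R : HahnSeries ℤ ℤ, R.DegLE (D - k) ∧ P = oneSub ^ k * R := by
  rcases h with ⟨rfl, Q, hQ, rfl⟩ | ⟨_, h⟩
  · refine ⟨_, ?_, (one_mul _).symm⟩
    have := (degLE_single D).add ((degLE_oneSub.mul hQ).mono (by lia : _ ≤ D))
    exact this.mono (by simp)
  · exact h

/-- Values at `X = 1` multiply and orders of vanishing add. -/
theorem VanishingType.mul {k l : ℕ} {D E : ℤ} {P Q : HahnSeries ℤ ℤ}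
    (hP : VanishingType k D P) (hQ : VanishingType l E Q) :
    VanishingType (k + l) (D + E) (P * Q) := by
  by_cases h : k + l = 0
  · have hk : k = 0 := by lia
    have hl : l = 0 := by lia
    subst hk hl
    obtain ⟨_, A, hA, rfl⟩ | ⟨h0, _⟩ := hP
    swap
    · exact absurd rfl h0
    obtain ⟨_, B, hB, rfl⟩ | ⟨h0, _⟩ := hQ
    swap
    · exact absurd rfl h0
    refine Or.inl ⟨rfl, single D 1 * B + (A * single E 1 + oneSub * (A * B)), ?_, ?_⟩
    · refine (((degLE_single D).mul hB).mono (by lia)).add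
        (((hA.mul (degLE_single E)).mono (by lia)).add
        ((degLE_oneSub.mul (hA.mul hB)).mono (by lia)))
    · have : single (D + E) (1 : ℤ) = single D 1 * single E 1 := by simp [single_mul_single]
      rw [this]
      ring
  · obtain ⟨R, hR, rfl⟩ := hP.exists_pow_mul
    obtain ⟨S, hS, rfl⟩ := hQ.exists_pow_mul
    refine Or.inr ⟨h, R * S, (hR.mul hS).mono (by push_cast; lia), by ring⟩

theorem vanishingType_zero {k : ℕ} (hk : k ≠ 0) (D : ℤ) : VanishingType k D 0 :=
  Or.inr ⟨hk, 0, fun _ _ => rfl, by simp⟩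

theorem vanishingType_single (D : ℤ) : VanishingType 0 D (single D 1) :=
  Or.inl ⟨rfl, 0, fun _ _ => rfl, by simp⟩

/-- The only solution of `(1 - X) f = X ^ D` has all coefficients from degree `D` on equal
to `1`. -/
theorem coeff_eq_of_oneSub_mul_eq_single {f : HahnSeries ℤ ℤ} {D : ℤ}
    (h : oneSub * f = single D 1) (n : ℤ) (hn : D ≤ n) : f.coeff n = 1 := by
  have hrec : ∀ n, f.coeff n = f.coeff (n - 1) + (single D (1 : ℤ)).coeff n := fun n => by
    rw [← h, coeff_oneSub_mul]; ring
  have hlow : ∀ n, n < D → f.coeff n = 0 := by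
    intro n hn
    by_contra hne
    -- Below `D` the coefficients are constant, so a nonzero one would persist to `-∞`, against the
    -- support being bounded below.
    have hstep : ∀ j : ℕ, f.coeff (n - j) ≠ 0 := by
      intro j
      induction j with
      | zero => simpa using hne
      | succ j ih =>
        rw [hrec, coeff_single_of_ne (by lia), add_zero] at ih
        convert ih using 2
        push_cast
        ring
    have h1 := order_le_of_coeff_ne_zero (hstep (n - f.order + 1).toNat)
    have h2 := order_le_of_coeff_ne_zero hne
    lia
  obtain ⟨j, rfl⟩ := Int.le.dest hn
  clear hn
  induction j with
  | zero => rw [hrec, hlow _ (by lia)]; simp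
  | succ j ih =>
    rw [hrec, coeff_single_of_ne (by lia), add_zero]
    convert ih using 2
    push_cast
    ring

/-- `f` is the geometric series starting at `X^D` plus some `Q` of degree below `D`. -/
theorem VanishingType.coeff_eq_one {f : HahnSeries ℤ ℤ} {D : ℤ}
    (h : VanishingType 0 D (oneSub * f)) (n : ℤ) (hn : D ≤ n) : f.coeff n = 1 := by
  obtain ⟨_, Q, hQ, hf⟩ | ⟨h0, _⟩ := h
  swap
  · exact absurd rfl h0
  have := coeff_eq_of_oneSub_mul_eq_single (f := f - Q) (D := D) (by rw [mul_sub, hf]; ring) n hn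
  rwa [coeff_sub, hQ n (by lia), sub_zero] at this

theorem vanishingType_zero_of_coeff_eq_one {f : HahnSeries ℤ ℤ} {D : ℤ}
    (h : ∀ n, D ≤ n → f.coeff n = 1) : VanishingType 0 D (oneSub * f) := by
  let g : HahnSeries ℤ ℤ := ofSuppBddBelow (fun n => if D ≤ n then 1 else 0)
    ⟨D, fun n hn => by simpa using hn⟩
  have hg : ∀ n, g.coeff n = if D ≤ n then 1 else 0 := fun _ => rfl
  refine Or.inl ⟨rfl, f - g, fun n hn => ?_, ?_⟩
  · simp [hg, h n (by lia), (by lia : D ≤ n)]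
  · rw [mul_sub, add_comm, sub_add]
    refine (sub_eq_self.2 (sub_eq_zero.2 ?_)).symm
    ext n
    rw [coeff_oneSub_mul]
    by_cases hn : n = D
    · subst hn; simp [hg]
    · rw [coeff_single_of_ne hn]
      by_cases h1 : D ≤ n
      · simp [hg, h1, (by lia : D < n)]
      · simp [hg, h1, (by lia : n ≤ D)]

/-- Cancelling `(1 - X)^j` lowers the degree bound from `D` to `D - j`. -/
theorem VanishingType.coeff_eq_zero {f : HahnSeries ℤ ℤ} {k j : ℕ} {D : ℤ}
    (h : VanishingType k D (oneSub ^ j * f)) (hjk : j ≤ k) (n : ℤ) (hn : D - j < n) :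
    f.coeff n = 0 := by
  obtain ⟨R, hR, hf⟩ := h.exists_pow_mul
  obtain ⟨i, rfl⟩ := Nat.exists_eq_add_of_le hjk
  rw [show oneSub ^ (j + i) = oneSub ^ j * oneSub ^ i by ring, mul_assoc] at hf
  rw [mul_left_cancel₀ (pow_ne_zero _ oneSub_ne_zero) hf]
  exact (degLE_oneSub_pow i).mul hR n (by push_cast; lia)

end HahnSeries

/-! ### Elimination of leaves on a tree. -/

namespace SimpleGraph

open HahnSeries

universe u

open Classical in
/-- The sum of the values of `m` at the neighbours of `v`. -/
noncomputable def nbrSum {V : Type*} [Fintype V] {R : Type*} [AddCommMonoid R]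
    (G : SimpleGraph V) (m : V → R) (v : V) : R :=
  ∑ y, if G.Adj v y then m y else 0

/-- The graph obtained by removing the vertex `u`. -/
abbrev removeVertex {V : Type*} (G : SimpleGraph V) (u : V) : SimpleGraph {j // j ≠ u} :=
  G.comap Subtype.val

variable {V : Type u} [Fintype V] [DecidableEq V] (G : SimpleGraph V)

open Classical in
theorem nbrSum_eq_add_removeVertex {R : Type*} [AddCommMonoid R] (m : V → R) (u v : V) :
    G.nbrSum m v = (if G.Adj v u then m u else 0) +
      ∑ y : {j // j ≠ u}, if G.Adj v y then m y else 0 :=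
  Fintype.sum_eq_add_sum_subtype_ne _ u

section leaf

variable {G} {u p : V} (hp : ∀ y, G.Adj u y ↔ y = p)
include hp

theorem nbrSum_leaf {R : Type*} [AddCommMonoid R] (m : V → R) : G.nbrSum m u = m p := by
  simp [nbrSum, hp]

theorem nbrSum_of_leaf {R : Type*} [AddCommMonoid R] (m : V → R) (v : {j // j ≠ u}) :
    G.nbrSum m v = (if v.1 = p then m u else 0) +
      (G.removeVertex u).nbrSum (fun y => m y) v := by
  rw [nbrSum_eq_add_removeVertex G m u v]
  simp only [G.adj_comm v.1 u, hp]
  rfl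

end leaf

/-- The contribution of `m` to a sum of products of coefficients of Laurent series that are
attached to the vertices of `G`. -/
noncomputable def vertexProduct (Ψ : V → ℤ → HahnSeries ℤ ℤ) (m : V → ℤ) : ℤ :=
  ∏ v, (Ψ v (m v)).coeff (-G.nbrSum m v)

/-- The properties of a system of Laurent series which are stable under the elimination of
leaves different from `w`, and which force the sum of all its vertex products to vanish. -/
structure IsAdmissible (w : V) (br : V → Bool) (κ : V → ℚ) (τ : V → ℕ)
    (Ψ : V → ℤ → HahnSeries ℤ ℤ) : Prop where
  posDef : ∀ x : V → ℚ, x ≠ 0 → 0 < ∑ v, x v * (κ v * x v - G.nbrSum x v)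
  eq_zero : ∀ s < 0, Ψ w s = 0
  order : ∀ v, ∃ K : ℚ, ∀ (s n : ℤ), (Ψ v s).coeff n ≠ 0 → -κ v * s - K ≤ n
  -- Only `s ≥ 0` needs control: `m_w ≥ 0`, and for `s ≥ 0` the upper coefficients of a leaf series
  -- involve only values `t ≥ 0` at the leaf.
  type : ∀ v (s : ℤ), 0 ≤ s → ∃ P D,
    oneSub ^ 2 * Ψ v s = oneSub ^ (G.nbrSum (fun _ => 1) v : ℕ) * P ∧
    VanishingType (τ v) D P ∧
    (D : ℚ) ≤ 2 - (G.nbrSum (fun _ => 1) v : ℕ) - κ v * s ∧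
    (τ v ≠ 0 → (D : ℚ) < 2 - (G.nbrSum (fun _ => 1) v : ℕ) - κ v * s)
  branch : ∀ x y, G.Adj x y → x ≠ w → y ≠ w → br x = br y
  count : 2 ≤ τ w + (if ∃ x, x ≠ w ∧ br x = true ∧ τ x ≠ 0 then 1 else 0) +
    (if ∃ x, x ≠ w ∧ br x = false ∧ τ x ≠ 0 then 1 else 0)

namespace IsAdmissible

variable {G} {w : V} {br : V → Bool} {κ : V → ℚ} {τ : V → ℕ} {Ψ : V → ℤ → HahnSeries ℤ ℤ}

theorem pos (h : G.IsAdmissible w br κ τ Ψ) (v : V) : 0 < κ v := by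
  have := h.posDef (Pi.single v 1) (by simp)
  rw [Finset.sum_eq_single v (fun y _ hy => by simp [hy]) (by simp)] at this
  have h0 : G.nbrSum (Pi.single v (1 : ℚ)) v = 0 := by
    refine Finset.sum_eq_zero fun y _ => ?_
    split_ifs with hy
    · simp [hy.ne']
    · rfl
  simpa [h0] using this

theorem vertexProduct_eq_zero_of_subsingleton [Subsingleton V] (h : G.IsAdmissible w br κ τ Ψ)
    (m : V → ℤ) : G.vertexProduct Ψ m = 0 := by
  refine Finset.prod_eq_zero (Finset.mem_univ w) ?_
  have hn : ∀ {R : Type} [AddCommMonoid R] (m : V → R), G.nbrSum m w = 0 := by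
    intro R _ m
    refine Finset.sum_eq_zero fun y _ => ?_
    rw [if_neg]
    rw [Subsingleton.elim y w]
    exact G.loopless.irrefl w
  rcases lt_or_ge (m w) 0 with hm | hm
  · simp [h.eq_zero _ hm]
  · obtain ⟨P, D, hP, hT, -, hD⟩ := h.type w (m w) hm
    have hc := h.count
    have h0 : ∀ b : Bool, ¬ ∃ x, x ≠ w ∧ br x = b ∧ τ x ≠ 0 := by
      rintro b ⟨x, hx, -⟩
      exact hx (Subsingleton.elim _ _)
    rw [if_neg (h0 _), if_neg (h0 _)] at hc
    rw [hn, pow_zero, one_mul] at hP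
    rw [hn, neg_zero]
    rw [hn] at hD
    subst hP
    -- Both branch terms of `count` are gone, so `τ w ≥ 2`; the strict degree bound gives `D < 2`.
    refine hT.coeff_eq_zero (by lia) 0 ?_
    have h1 := hD (by lia)
    have h2 : (0 : ℚ) ≤ κ w * m w := mul_nonneg (h.pos w).le (by exact_mod_cast hm)
    have : (D : ℚ) < 2 := by push_cast at h1; linarith
    have : D < 2 := by exact_mod_cast this
    push_cast
    lia

/-- The generating function of a leaf `u`, depending on the value `s` at its neighbour. -/
theorem exists_leafSeries (h : G.IsAdmissible w br κ τ Ψ) (u : V) :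
    ∃ ψ : ℤ → HahnSeries ℤ ℤ, (∀ s t, (ψ s).coeff t = (Ψ u t).coeff (-s)) ∧
      ∃ K : ℚ, ∀ (s t : ℤ), (ψ s).coeff t ≠ 0 → (κ u)⁻¹ * s - K ≤ t := by
  obtain ⟨K, hK⟩ := h.order u
  have hκ := h.pos u
  -- Since `κ u > 0`, the lower bound on degrees in `Ψ u t` turns into a lower bound on `t`.
  have key : ∀ s t : ℤ, (Ψ u t).coeff (-s) ≠ 0 → (κ u)⁻¹ * s - (κ u)⁻¹ * K ≤ t := by
    intro s t hst
    have := hK t (-s) hst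
    rw [← mul_sub, inv_mul_le_iff₀ hκ]
    push_cast at this
    linarith
  refine ⟨fun s => ofSuppBddBelow (fun t => (Ψ u t).coeff (-s))
    ⟨⌈(κ u)⁻¹ * s - (κ u)⁻¹ * K⌉, fun t ht => Int.ceil_le.2 (key s t ht)⟩,
    fun _ _ => rfl, _, key⟩

/-- For `t` beyond `s / κ_u`, degree `-s` lies in the stable range of `Ψ_u(t)`, where the
coefficients are `1` if `τ_u = 0` and `0` otherwise. So `ψ(s)` is either eventually `1` or a Laurent
polynomial. -/
theorem type_leafSeries (h : G.IsAdmissible w br κ τ Ψ) {u p : V} (hp : ∀ y, G.Adj u y ↔ y = p)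
    {ψ : ℤ → HahnSeries ℤ ℤ} (hψ : ∀ s t, (ψ s).coeff t = (Ψ u t).coeff (-s))
    (s : ℤ) (hs : 0 ≤ s) : ∃ D : ℤ,
      VanishingType (if τ u = 0 then 0 else 1) D (oneSub * ψ s) ∧
      (D : ℚ) ≤ (κ u)⁻¹ * s + 1 ∧ (τ u ≠ 0 → (D : ℚ) < (κ u)⁻¹ * s + 1) := by
  have hκ := h.pos u
  have hκ' := inv_pos.2 hκ
  have hsQ : (0 : ℚ) ≤ s := by exact_mod_cast hs
  have hdeg : (G.nbrSum (fun _ => 1) u : ℕ) = 1 := nbrSum_leaf hp _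
  have htype : ∀ t : ℤ, 0 ≤ t → ∃ D : ℤ, VanishingType (τ u) D (oneSub * Ψ u t) ∧
      (D : ℚ) ≤ 1 - κ u * t ∧ (τ u ≠ 0 → (D : ℚ) < 1 - κ u * t) := by
    intro t ht
    obtain ⟨P, D, hP, hT, hD, hD'⟩ := h.type u t ht
    rw [hdeg, pow_one, pow_two, mul_assoc] at hP
    rw [hdeg] at hD hD'
    have := mul_left_cancel₀ oneSub_ne_zero hP
    subst this
    refine ⟨D, hT, ?_, fun h0 => ?_⟩
    · push_cast at hD; linarith
    · have := hD' h0
      push_cast at this; linarith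
  by_cases h0 : τ u = 0
  -- Here the bound on `D` is not strict, so stability needs `t > s / κ_u`.
  · refine ⟨⌊(κ u)⁻¹ * s⌋ + 1, ?_, ?_, fun h1 => absurd h0 h1⟩
    · rw [if_pos h0]
      refine vanishingType_zero_of_coeff_eq_one fun t ht => ?_
      have ht1 : (κ u)⁻¹ * s < t := Int.floor_lt.1 (by lia)
      have ht0 : 0 ≤ t := by
        have : (0 : ℚ) < t := lt_of_le_of_lt (by positivity) ht1
        exact_mod_cast this.le
      obtain ⟨D, hT, hD, -⟩ := htype t ht0
      rw [h0] at hT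
      rw [hψ]
      refine hT.coeff_eq_one _ ?_
      rw [inv_mul_lt_iff₀ hκ] at ht1
      have : (D : ℚ) < -s + 1 := by linarith
      have : D < -s + 1 := by exact_mod_cast this
      lia
    · push_cast
      linarith [Int.floor_le ((κ u)⁻¹ * s)]
  -- Here it is strict, so `t ≥ s / κ_u` already suffices.
  · refine ⟨⌈(κ u)⁻¹ * s⌉, ?_, ?_, fun _ => Int.ceil_lt_add_one _⟩
    · rw [if_neg h0]
      refine Or.inr ⟨one_ne_zero, ψ s, fun t ht => ?_, by rw [pow_one]⟩
      have ht1 : (κ u)⁻¹ * s ≤ t := Int.ceil_le.1 (by push_cast at ht; lia)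
      have ht0 : 0 ≤ t := by
        have : (0 : ℚ) ≤ t := le_trans (by positivity) ht1
        exact_mod_cast this
      obtain ⟨D, hT, -, hD⟩ := htype t ht0
      rw [hψ]
      refine VanishingType.coeff_eq_zero (j := 1) (k := τ u) (D := D) (by rwa [pow_one])
        (by lia) _ ?_
      have h1 := hD h0
      rw [inv_mul_le_iff₀ hκ] at ht1
      have : (D : ℚ) < -s + 1 := by linarith
      have : D < -s + 1 := by exact_mod_cast this
      push_cast
      lia
    · exact (Int.ceil_lt_add_one _).le

/-- Admissibility is preserved by the elimination of a leaf. -/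
theorem removeVertex (h : G.IsAdmissible w br κ τ Ψ) {u p : V}
    (hp : ∀ y, G.Adj u y ↔ y = p) (hwu : w ≠ u) {ψ : ℤ → HahnSeries ℤ ℤ}
    (hψ : ∀ s t, (ψ s).coeff t = (Ψ u t).coeff (-s))
    (hK : ∃ K : ℚ, ∀ (s t : ℤ), (ψ s).coeff t ≠ 0 → (κ u)⁻¹ * s - K ≤ t) :
    (G.removeVertex u).IsAdmissible ⟨w, hwu⟩ (fun v => br v)
      (fun v => κ v - if v.1 = p then (κ u)⁻¹ else 0)
      (fun v => τ v + if v.1 = p then (if τ u = 0 then 0 else 1) else 0)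
      (fun v s => if v.1 = p then Ψ v s * ψ s else Ψ v s) := by
  have hpu : p ≠ u := ((hp p).2 rfl).ne'
  have hdeg := fun v => nbrSum_of_leaf hp (fun _ => (1 : ℕ)) v
  constructor
  · intro x hx
    -- The value at `u` minimises the form for given `x`, so the `u`-term vanishes and the reduced
    -- form remains.
    let y : V → ℚ := fun v => if hv : v = u then (κ u)⁻¹ * x ⟨p, hpu⟩ else x ⟨v, hv⟩
    have hyu : y u = (κ u)⁻¹ * x ⟨p, hpu⟩ := by simp [y]
    have hyx : ∀ v : {j // j ≠ u}, y v = x v := fun v => by simp [y, v.2]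
    have hy : y ≠ 0 := by
      rintro h0
      refine hx (funext fun v => ?_)
      rw [← hyx v, h0]; rfl
    have := h.posDef y hy
    rw [Fintype.sum_eq_add_sum_subtype_ne _ u, nbrSum_leaf hp, hyu, mul_inv_cancel_left₀ (h.pos u).ne',
      ← hyx ⟨p, hpu⟩, sub_self, mul_zero, zero_add] at this
    refine this.trans_eq (Finset.sum_congr rfl fun v _ => ?_)
    rw [nbrSum_of_leaf hp, hyu]
    simp only [hyx]
    congr 1
    split_ifs with hv
    · have : v = ⟨p, hpu⟩ := Subtype.ext hv
      subst this
      ring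
    · ring
  · intro s hs
    simp [h.eq_zero s hs]
  · intro v
    obtain ⟨K, hK⟩ := hK
    obtain ⟨L, hL⟩ := h.order v
    split_ifs with hv
    · refine ⟨L + K, fun s n hn => ?_⟩
      have := le_of_coeff_mul_ne_zero (hL s) (hK s) n hn
      linarith
    · exact ⟨L, fun s n hn => by simpa using hL s n hn⟩
  · intro v s hs
    obtain ⟨P, D, hP, hT, hD, hD'⟩ := h.type v s hs
    rw [hdeg v] at hP hD hD'
    by_cases hv : v.1 = p
    · simp only [if_pos hv] at hP hD hD' ⊢
      obtain ⟨E, hE, hE1, hE2⟩ := h.type_leafSeries hp hψ s hs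
      push_cast at hD hD' ⊢
      -- The factor `1 - X` freed by the drop of the degree of `p` is absorbed by `ψ s`; the `+ 1`
      -- in the bound on `E` compensates for it.
      refine ⟨P * (oneSub * ψ s), D + E, ?_, hT.mul hE, ?_, fun h0 => ?_⟩
      · rw [← mul_assoc, hP, _root_.pow_add, pow_one]; ring
      · push_cast
        linarith
      · push_cast
        by_cases h1 : τ v = 0
        · have := hE2 (by rintro h2; simp [h1, h2] at h0)
          linarith
        · have := hD' h1
          linarith
    · simp only [if_neg hv, zero_add] at hP hD hD' ⊢
      exact ⟨P, D, hP, by simpa using hT, by simpa using hD, by simpa using hD'⟩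
  · intro x y hxy hx hy
    exact h.branch x y hxy (fun h => hx (Subtype.ext h)) (fun h => hy (Subtype.ext h))
  · have hc := h.count
    -- A condition carried by `u` passes to `p`, which has the same colour unless `p = w`.
    have hmono : ∀ b, (∃ x, x ≠ w ∧ br x = b ∧ τ x ≠ 0) → ¬ (p = w ∧ br u = b ∧ τ u ≠ 0) →
        ∃ x : {j // j ≠ u}, x ≠ ⟨w, hwu⟩ ∧ br x = b ∧
          (τ x + if x.1 = p then (if τ u = 0 then 0 else 1) else 0) ≠ 0 := by
      rintro b ⟨x, hxw, hxb, hxτ⟩ hb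
      by_cases hxu : x = u
      · subst hxu
        have hpw : p ≠ w := fun hpw => hb ⟨hpw, hxb, hxτ⟩
        refine ⟨⟨p, hpu⟩, fun h => hpw (congrArg Subtype.val h), ?_, by simp [hxτ]⟩
        rw [← hxb]
        exact (h.branch _ _ ((hp p).2 rfl) hxw hpw).symm
      · exact ⟨⟨x, hxu⟩, fun h => hxw (congrArg Subtype.val h), hxb, by simp [hxτ]⟩
    have hle : ∀ {A B : Prop} [Decidable A] [Decidable B], (A → B) →
        (if A then 1 else 0) ≤ (if B then 1 else 0 : ℕ) := by
      intro A B _ _ hAB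
      split_ifs <;> simp_all
    have hle_one : ∀ {A : Prop} [Decidable A], (if A then 1 else 0 : ℕ) ≤ 1 := by
      intro A _
      split_ifs <;> simp
    -- If `w` absorbs a constrained leaf, `τ w` grows by `1`, making up for the possible loss of the
    -- leaf's colour.
    by_cases hu : p = w ∧ τ u ≠ 0
    · refine hc.trans ?_
      have h1 : (if w = p then (if τ u = 0 then 0 else 1) else 0 : ℕ) = 1 := by
        rw [if_pos hu.1.symm, if_neg hu.2]
      simp only [h1]
      cases hbu : br u
      · have := hle fun h => hmono true h (by simp [hbu])
        refine (add_le_add (add_le_add_right this _) hle_one).trans ?_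
        lia
      · have := hle fun h => hmono false h (by simp [hbu])
        refine (add_le_add (add_le_add_right hle_one _) this).trans ?_
        lia
    · refine hc.trans (add_le_add (add_le_add (Nat.le_add_right _ _)
        (hle fun h => hmono true h fun h => hu ⟨h.1, h.2.2⟩))
        (hle fun h => hmono false h fun h => hu ⟨h.1, h.2.2⟩))

/-- Only the factors at `u` and `p` depend on `t`, and their sum over `t` is a convolution. -/
theorem vertexProduct_removeVertex {u p : V} (hp : ∀ y, G.Adj u y ↔ y = p)
    {ψ : ℤ → HahnSeries ℤ ℤ} (hψ : ∀ s t, (ψ s).coeff t = (Ψ u t).coeff (-s))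
    (m : {j // j ≠ u} → ℤ) :
    (G.removeVertex u).vertexProduct (fun v s => if v.1 = p then Ψ v s * ψ s else Ψ v s) m =
      ∑ᶠ t, G.vertexProduct Ψ ((Equiv.funSplitAt u ℤ).symm (t, m)) := by
  have hpu : p ≠ u := ((hp p).2 rfl).ne'
  have hv : ∀ v : {j // j ≠ u}, v ≠ ⟨p, hpu⟩ → v.1 ≠ p := fun v hv h => hv (Subtype.ext h)
  have hext : ∀ t, ((Equiv.funSplitAt u ℤ).symm (t, m)) u = t := fun t => by
    simp [Equiv.funSplitAt]
  have hext' : ∀ t, ∀ v : {j // j ≠ u}, ((Equiv.funSplitAt u ℤ).symm (t, m)) v = m v :=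
    fun t v => by simp [Equiv.funSplitAt, v.2]
  have hR : ∀ t, G.vertexProduct Ψ ((Equiv.funSplitAt u ℤ).symm (t, m)) =
      (∏ v ∈ Finset.univ.erase (⟨p, hpu⟩ : {j // j ≠ u}),
        (Ψ v (m v)).coeff (-(G.removeVertex u).nbrSum m v)) •
      ((ψ (m ⟨p, hpu⟩)).coeff t * (Ψ p (m ⟨p, hpu⟩)).coeff
        (-(G.removeVertex u).nbrSum m ⟨p, hpu⟩ - t)) := by
    intro t
    have hp1 := nbrSum_of_leaf hp ((Equiv.funSplitAt u ℤ).symm (t, m)) ⟨p, hpu⟩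
    simp only [hext, hext', if_true] at hp1
    have hp2 := hext' t ⟨p, hpu⟩
    rw [vertexProduct, Fintype.prod_eq_mul_prod_subtype_ne _ u, nbrSum_leaf hp, hext,
      hp2, hψ, ← Finset.mul_prod_erase _ _ (Finset.mem_univ ⟨p, hpu⟩), smul_eq_mul]
    simp only [nbrSum_of_leaf hp, hext, hext']
    rw [Finset.prod_congr rfl fun v hv' => by
      rw [if_neg (hv v (Finset.ne_of_mem_erase hv')), zero_add]]
    rw [hp1, hp2, neg_add, neg_add_eq_sub]
    ring
  simp only [hR]
  rw [← smul_finsum, ← coeff_mul_eq_finsum, vertexProduct,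
    ← Finset.mul_prod_erase _ _ (Finset.mem_univ ⟨p, hpu⟩), if_pos rfl, smul_eq_mul, mul_comm]
  congr 1
  refine Finset.prod_congr rfl fun v hv' => ?_
  rw [if_neg (hv v (Finset.ne_of_mem_erase hv'))]

/-- The sum of all vertex products of an admissible system on a tree vanishes. -/
theorem finsum_vertexProduct_eq_zero (hG : G.IsTree) (h : G.IsAdmissible w br κ τ Ψ)
    (hfin : (Function.support (G.vertexProduct Ψ)).Finite) :
    ∑ᶠ m, G.vertexProduct Ψ m = 0 := by
  induction hn : Fintype.card V generalizing V with
  | zero => exact ((Fintype.card_eq_zero_iff.1 hn).false w).elim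
  | succ n ih =>
  classical
  rcases subsingleton_or_nontrivial V with hV | hV
  · simp [h.vertexProduct_eq_zero_of_subsingleton]
  obtain ⟨u, huw, hu⟩ : ∃ u, u ≠ w ∧ G.degree u = 1 := by
    obtain ⟨u, v, huv, hu, hv⟩ := hG.exists_ne_and_degree_eq_one
    by_cases huw : u = w
    · exact ⟨v, huw ▸ huv.symm, hv⟩
    · exact ⟨u, huw, hu⟩
  obtain ⟨p, hp0, hp1⟩ := degree_eq_one_iff_existsUnique_adj.1 hu
  have hp : ∀ y, G.Adj u y ↔ y = p := fun y => ⟨hp1 y, fun hy => hy ▸ hp0⟩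
  have hG' : (G.removeVertex u).IsTree :=
    ⟨hG.1.induce_compl_singleton_of_degree_eq_one hu, hG.2.induce {u}ᶜ⟩
  obtain ⟨ψ, hψ, hK⟩ := h.exists_leafSeries u
  have hsum := vertexProduct_removeVertex (Ψ := Ψ) hp hψ
  have h0 := ih hG' (h.removeVertex hp huw.symm hψ hK) (by
    refine (hfin.image fun m v => m v.1).subset fun m hm => ?_
    rw [Function.mem_support, hsum] at hm
    obtain ⟨t, ht⟩ : ∃ t, G.vertexProduct Ψ ((Equiv.funSplitAt u ℤ).symm (t, m)) ≠ 0 := by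
      by_contra! h0
      exact hm (by simp [h0])
    exact ⟨_, ht, funext fun v => by simp [Equiv.funSplitAt, v.2]⟩)
    (by simp [Fintype.card_subtype_compl, hn])
  simp only [hsum] at h0
  rw [← finsum_comp_equiv ((Equiv.prodComm _ _).trans (Equiv.funSplitAt u ℤ).symm),
    finsum_curry]
  · exact h0
  · exact hfin.preimage (Equiv.injective _).injOn

end IsAdmissible

end SimpleGraph

/-! ### Coefficients of the Poincaré series. -/

namespace PlumbingGraph

open HahnSeries

/-- The power series `1 - X` in one variable, as an invertible power series. -/
noncomputable def oneSubUnit : (PowerSeries ℤ)ˣ :=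
  IsUnit.unit (a := 1 - PowerSeries.X) (by
    rw [PowerSeries.isUnit_iff_constantCoeff]; simp)

theorem val_oneSubUnit : (oneSubUnit : PowerSeries ℤ) = 1 - PowerSeries.X := rfl

/-- The Laurent series expansion of `(1 - X) ^ e`. -/
noncomputable def oneSubZPow (e : ℤ) : HahnSeries ℤ ℤ :=
  ofPowerSeries ℤ ℤ ((oneSubUnit ^ e : (PowerSeries ℤ)ˣ) : PowerSeries ℤ)

theorem coeff_oneSubZPow_natCast (e : ℤ) (n : ℕ) : (oneSubZPow e).coeff n =
    PowerSeries.coeff n ((oneSubUnit ^ e : (PowerSeries ℤ)ˣ) : PowerSeries ℤ) :=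
  ofPowerSeries_apply_coeff _ _

theorem coeff_oneSubZPow_of_neg (e : ℤ) {n : ℤ} (hn : n < 0) : (oneSubZPow e).coeff n = 0 := by
  rw [oneSubZPow, ofPowerSeries_apply]
  refine embDomain_of_notMem_range ?_
  rintro ⟨k, rfl⟩
  simp at hn
  lia

theorem ofPowerSeries_oneSubUnit : ofPowerSeries ℤ ℤ (oneSubUnit : PowerSeries ℤ) = oneSub := by
  rw [val_oneSubUnit, map_sub, map_one, ofPowerSeries_X, oneSub]

theorem oneSub_sq_mul_oneSubZPow (d : ℕ) :
    oneSub ^ 2 * oneSubZPow ((d : ℤ) - 2) = oneSub ^ d := by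
  rw [← ofPowerSeries_oneSubUnit, oneSubZPow, ← map_pow, ← map_pow, ← map_mul]
  congr 1
  rw [← Units.val_pow_eq_pow_val, ← Units.val_pow_eq_pow_val, ← Units.val_mul]
  congr 1
  rw [← zpow_natCast, ← zpow_natCast, ← zpow_add]
  congr 1
  push_cast
  ring

theorem coeff_oneSubUnit_zpow_add_one (e : ℤ) (n : ℕ) :
    PowerSeries.coeff n ((oneSubUnit ^ (e + 1) : (PowerSeries ℤ)ˣ) : PowerSeries ℤ) =
      PowerSeries.coeff n ((oneSubUnit ^ e : (PowerSeries ℤ)ˣ) : PowerSeries ℤ) -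
      if n = 0 then 0 else
        PowerSeries.coeff (n - 1) ((oneSubUnit ^ e : (PowerSeries ℤ)ˣ) : PowerSeries ℤ) := by
  rw [zpow_add_one, Units.val_mul, val_oneSubUnit, mul_sub, mul_one, map_sub]
  cases n with
  | zero => simp
  | succ n => simp [PowerSeries.coeff_succ_mul_X]

section

variable {V : Type*} [DecidableEq V]

/-- The power series in the single variable `X v` with the coefficients of `(1 - X) ^ e`. -/
noncomputable def oneSubXSeries (v : V) (e : ℤ) : MvPowerSeries V ℤ := fun b =>
  if b = Finsupp.single v (b v) then
    PowerSeries.coeff (b v) ((oneSubUnit ^ e : (PowerSeries ℤ)ˣ) : PowerSeries ℤ) else 0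

theorem coeff_oneSubXSeries (v : V) (e : ℤ) (b : V →₀ ℕ) :
    MvPowerSeries.coeff b (oneSubXSeries v e) = if b = Finsupp.single v (b v) then
      PowerSeries.coeff (b v) ((oneSubUnit ^ e : (PowerSeries ℤ)ˣ) : PowerSeries ℤ) else 0 := rfl

theorem oneSubXSeries_zero (v : V) : oneSubXSeries v 0 = 1 := by
  ext b
  rw [coeff_oneSubXSeries, MvPowerSeries.coeff_one, zpow_zero, Units.val_one,
    PowerSeries.coeff_one]
  by_cases h : b = 0
  · simp [h]
  · rw [if_neg h]
    split_ifs with h1 h2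
    · rw [h2, Finsupp.single_zero] at h1
      exact absurd h1 h
    · rfl
    · rfl

theorem oneSubXSeries_add_one (v : V) (e : ℤ) :
    oneSubXSeries v (e + 1) = oneSubXSeries v e * (1 - MvPowerSeries.X v) := by
  ext b
  rw [mul_sub, mul_one, map_sub, MvPowerSeries.X, MvPowerSeries.coeff_mul_monomial, mul_one,
    coeff_oneSubXSeries, coeff_oneSubXSeries, coeff_oneSubXSeries, coeff_oneSubUnit_zpow_add_one]
  have hle : Finsupp.single v 1 ≤ b ↔ b v ≠ 0 := by
    rw [Finsupp.single_le_iff]; lia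
  by_cases h0 : b v = 0
  · simp [hle, h0]
  · rw [if_pos (hle.2 h0), if_neg h0]
    have hiff : (b - Finsupp.single v 1 = Finsupp.single v ((b - Finsupp.single v 1 : V →₀ ℕ) v)) ↔
        b = Finsupp.single v (b v) := by
      constructor
      · intro h
        ext y
        have := DFunLike.congr_fun h y
        by_cases hy : y = v
        · subst hy; simp
        · simpa [Finsupp.single_apply, Ne.symm hy] using this
      · intro h
        ext y
        have := DFunLike.congr_fun h y
        by_cases hy : y = v
        · subst hy; simp
        · simpa [Finsupp.single_apply, Ne.symm hy] using this
    simp only [hiff]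
    split_ifs
    · simp
    · simp

theorem val_oneSubX_zpow (v : V) (e : ℤ) :
    ((oneSubX v ^ e : (MvPowerSeries V ℤ)ˣ) : MvPowerSeries V ℤ) = oneSubXSeries v e := by
  have hX : ((oneSubX v : (MvPowerSeries V ℤ)ˣ) : MvPowerSeries V ℤ) =
    1 - MvPowerSeries.X v := rfl
  induction e using Int.induction_on with
  | zero => rw [zpow_zero, Units.val_one, oneSubXSeries_zero]
  | succ n ih => rw [zpow_add_one, Units.val_mul, ih, oneSubXSeries_add_one, hX]
  | pred n ih =>
    rw [← Units.mul_left_inj (oneSubX v), ← Units.val_mul, ← zpow_add_one, sub_add_cancel, ih,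
      hX, ← oneSubXSeries_add_one, sub_add_cancel]

/-- Each factor involves one variable only, so a single decomposition of `b` contributes. -/
theorem coeff_poincareSeries [Fintype V] (T : PlumbingGraph V) (b : V →₀ ℕ) :
    MvPowerSeries.coeff b T.poincareSeries =
      ∏ v, (oneSubZPow ((T.valency v : ℤ) - 2)).coeff (b v) := by
  rw [poincareSeries, Units.coe_prod]
  simp only [val_oneSubX_zpow, coeff_oneSubZPow_natCast]
  rw [MvPowerSeries.coeff_prod]
  rw [Finset.sum_eq_single (Finsupp.equivFunOnFinite.symm fun v => Finsupp.single v (b v))]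
  · simp [coeff_oneSubXSeries]
  · intro l hl hne
    by_contra h0
    refine hne ?_
    have hl' := (Finset.mem_finsuppAntidiag.1 hl).1
    have hs : ∀ v, l v = Finsupp.single v (l v v) := by
      intro v
      by_contra hv
      refine h0 (Finset.prod_eq_zero (Finset.mem_univ v) ?_)
      rw [coeff_oneSubXSeries, if_neg hv]
    have hb : ∀ v, l v v = b v := by
      intro v
      rw [← hl', Finsupp.finsetSum_apply, Finset.sum_eq_single v]
      · intro y _ hy
        rw [hs y, Finsupp.single_eq_of_ne hy.symm]
      · simp
    ext1 v
    rw [hs v, hb v]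
    simp
  · intro h
    refine absurd (Finset.mem_finsuppAntidiag.2 ⟨?_, Finset.subset_univ _⟩) h
    ext v
    simp

end

/-! ### Separation by vertices of the closure. -/

/-- A vertex of the closure of `I` outside of `I` separates two elements of `I`. -/
theorem IsClosure.exists_separation {V : Type*} [DecidableEq V] {T : PlumbingGraph V}
    (hT : T.graph.IsTree)
    {I K : Set V} (hI : I.Nonempty) (hK : T.IsClosure I K) {w : V} (hwK : w ∈ K) (hwI : w ∉ I) :
    ∃ br : V → Bool, (∀ x y, T.graph.Adj x y → x ≠ w → y ≠ w → br x = br y) ∧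
      ∃ x ∈ I, ∃ y ∈ I, br x = true ∧ br y = false := by
  classical
  obtain ⟨x, hx⟩ := hI
  have hIK := hK.prop.1
  let C : Set V := {v | ∃ p : T.graph.Walk x v, ∀ z ∈ p.support, z ∈ K \ {w}}
  have hxC : x ∈ C := ⟨SimpleGraph.Walk.nil, fun z hz => by
    rw [SimpleGraph.Walk.support_nil, List.mem_singleton] at hz
    subst hz
    exact ⟨hIK hx, fun h => hwI (h ▸ hx)⟩⟩
  have hCK : C ⊆ K \ {w} := fun v ⟨p, hp⟩ => hp v p.end_mem_support
  have hC : (T.graph.induce C).Connected := by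
    refine SimpleGraph.induce_connected_of_patches x hxC fun {v} ⟨p, hp⟩ => ?_
    refine ⟨{z | z ∈ p.support}, fun z hz => ⟨p.takeUntil z hz, fun y hy =>
      hp y (p.support_takeUntil_subset_support hz hy)⟩, p.start_mem_support, p.end_mem_support,
      (p.connected_induce_support).preconnected _ _⟩
  -- Otherwise `C` would be a connected set containing `I` and missing `w`, against minimality of
  -- `K`.
  obtain ⟨y, hyI, hyC⟩ : ∃ y ∈ I, y ∉ C := by
    by_contra! h
    exact (hCK (hK.2 ⟨h, hC⟩ (hCK.trans Set.sdiff_subset) hwK)).2 rfl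
  refine ⟨fun v => decide (∃ p : T.graph.Walk x v, w ∉ p.support), ?_, x, hx, y, hyI, ?_, ?_⟩
  · intro a b hab ha hb
    have key : ∀ {a b}, T.graph.Adj a b → b ≠ w → (∃ p : T.graph.Walk x a, w ∉ p.support) →
        ∃ p : T.graph.Walk x b, w ∉ p.support := by
      rintro a b hab hb ⟨p, hp⟩
      refine ⟨p.concat hab, ?_⟩
      rw [SimpleGraph.Walk.support_concat]
      simp [hp, hb.symm]
    exact decide_eq_decide.2 ⟨key hab hb, key hab.symm ha⟩
  · refine decide_eq_true ⟨SimpleGraph.Walk.nil, ?_⟩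
    rw [SimpleGraph.Walk.support_nil, List.mem_singleton]
    exact fun h => hwI (h ▸ hx)
  · refine decide_eq_false ?_
    rintro ⟨p, hp⟩
    obtain ⟨r⟩ := hK.prop.2.preconnected ⟨x, hIK hx⟩ ⟨y, hIK hyI⟩
    let r' : T.graph.Walk x y := r.map (SimpleGraph.Embedding.induce K).toHom
    have hr' : ∀ z ∈ r'.support, z ∈ K := by
      intro z hz
      have hs : r'.support = r.support.map (SimpleGraph.Embedding.induce K).toHom :=
        SimpleGraph.Walk.support_map _ _
      rw [hs, List.mem_map] at hz
      obtain ⟨z', -, rfl⟩ := hz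
      exact z'.2
    -- Paths in a tree are unique, so a path avoiding `w` would also lie in `K`, putting `y` in `C`.
    have heq := congrArg (fun q : T.graph.Path x y => q.1.support)
      ((hT.2.subsingleton_path x y).elim p.toPath r'.toPath)
    refine hyC ⟨p.bypass, fun z hz => ⟨hr' z ?_, ?_⟩⟩
    · refine r'.support_bypass_subset_support ?_
      have : p.bypass.support = r'.bypass.support := heq
      rwa [this] at hz
    · rintro rfl
      exact hp (p.support_bypass_subset_support hz)

end PlumbingGraph

/-! ### Dual coordinates, positivity of `E*_v`, finiteness. -/

namespace PlumbingGraph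

open HahnSeries

section

variable {V : Type*} [Fintype V] (T : PlumbingGraph V)

/-- The coefficients `-(x, E_v)` of `x` with respect to the basis `E*_v`. -/
noncomputable def dualCoeff (x : V → ℚ) (v : V) : ℚ := -T.euler v * x v - T.graph.nbrSum x v

theorem dualCoeff_intCast (m : V → ℤ) : T.dualCoeff (fun v => (m v : ℚ)) =
    fun v => ((-T.euler v * m v - T.graph.nbrSum m v : ℤ) : ℚ) := by
  ext v
  simp only [dualCoeff, SimpleGraph.nbrSum]
  push_cast
  rfl

theorem valency_eq_nbrSum (v : V) : T.valency v = T.graph.nbrSum (fun _ => 1) v := by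
  classical
  rw [valency, SimpleGraph.nbrSum, Finset.sum_boole, ← SimpleGraph.card_neighborFinset_eq_degree,
    SimpleGraph.neighborFinset_eq_filter, Nat.cast_id]

end

variable {V : Type*} [Fintype V] [DecidableEq V] (T : PlumbingGraph V)

theorem intersectionMatrix_mulVec (x : V → ℚ) :
    (T.intersectionMatrix.map (Int.cast : ℤ → ℚ)).mulVec x = -T.dualCoeff x := by
  classical
  ext v
  have h : ∀ y, (T.intersectionMatrix.map (Int.cast : ℤ → ℚ)) v y * x y =
      (if v = y then T.euler v * x y else 0) + if T.graph.Adj v y then x y else 0 := by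
    intro y
    simp only [Matrix.map_apply, intersectionMatrix, Matrix.of_apply]
    by_cases hv : v = y
    · subst hv; simp
    · by_cases ha : T.graph.Adj v y <;> simp [hv, ha]
  rw [Matrix.mulVec, dotProduct, Finset.sum_congr rfl fun y _ => h y, Finset.sum_add_distrib,
    Finset.sum_ite_eq, if_pos (Finset.mem_univ v), Pi.neg_apply, dualCoeff, SimpleGraph.nbrSum]
  ring_nf

theorem sum_mul_dualCoeff_pos (hNeg : T.IsNegDef) (x : V → ℚ) (hx : x ≠ 0) :
    0 < ∑ v, x v * (-T.euler v * x v - T.graph.nbrSum x v) := by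
  have h := hNeg x hx
  rw [form, Matrix.toBilin'_apply', intersectionMatrix_mulVec, dotProduct_neg, neg_lt_zero] at h
  exact h

theorem sum_smul_Estar (b : V → ℚ) :
    ∑ v, b v • T.Estar v = -(T.intersectionMatrix.map (Int.cast : ℤ → ℚ))⁻¹.mulVec b := by
  ext w
  simp [Finset.sum_apply, Estar, Matrix.mulVec, dotProduct, mul_comm]

theorem dualCoeff_sum_smul_Estar (hNeg : T.IsNegDef) (b : V → ℚ) :
    T.dualCoeff (∑ v, b v • T.Estar v) = b := by
  have h := T.intersectionMatrix_mulVec (∑ v, b v • T.Estar v)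
  rw [sum_smul_Estar, Matrix.mulVec_neg, Matrix.mulVec_mulVec, Matrix.mul_nonsing_inv _
    (isUnit_iff_ne_zero.2 (T.det_ne_zero hNeg)), Matrix.one_mulVec, neg_inj] at h
  rw [sum_smul_Estar, ← h]

theorem sum_dualCoeff_smul_Estar (hNeg : T.IsNegDef) (x : V → ℚ) :
    ∑ v, T.dualCoeff x v • T.Estar v = x := by
  rw [sum_smul_Estar, ← Matrix.mulVec_neg, ← intersectionMatrix_mulVec, Matrix.mulVec_mulVec,
    Matrix.nonsing_inv_mul _ (isUnit_iff_ne_zero.2 (T.det_ne_zero hNeg)), Matrix.one_mulVec]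

theorem dualCoeff_Estar (hNeg : T.IsNegDef) (v : V) :
    T.dualCoeff (T.Estar v) = Pi.single v 1 := by
  have := T.dualCoeff_sum_smul_Estar hNeg (Pi.single v 1)
  rwa [Finset.sum_eq_single v (fun y _ hy => by simp [hy]) (by simp), Pi.single_eq_same,
    one_smul] at this

theorem sum_nsmul_Estar_eq_iff (hNeg : T.IsNegDef) (b : V → ℕ) (x : V → ℚ) :
    ∑ v, b v • T.Estar v = x ↔ T.dualCoeff x = fun v => (b v : ℚ) := by
  have h : ∑ v, b v • T.Estar v = ∑ v, (b v : ℚ) • T.Estar v :=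
    Finset.sum_congr rfl fun v _ => (Nat.cast_smul_eq_nsmul ℚ _ _).symm
  rw [h]
  constructor
  · rintro rfl
    exact T.dualCoeff_sum_smul_Estar hNeg _
  · intro hb
    rw [← T.sum_dualCoeff_smul_Estar hNeg x, hb]

/-- The coordinates of the elements `E*_v` are non-negative. -/
theorem Estar_nonneg (hNeg : T.IsNegDef) (v u : V) : 0 ≤ T.Estar v u := by
  classical
  set y := T.Estar v with hy
  -- Pairing `y` with its negative part `n` gives `n v ≥ 0`. As off-diagonal entries are
  -- nonnegative, it also gives at most minus the positive definite form at `n`.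
  let n : V → ℚ := fun u => max (-y u) 0
  suffices h : n = 0 by
    have := congrFun h u
    have h1 : -y u ≤ n u := le_max_left _ _
    rw [this] at h1
    simpa using h1
  by_contra hn
  have h1 := T.sum_mul_dualCoeff_pos hNeg n hn
  have h2 : ∑ u, n u * T.dualCoeff y u = n v := by
    rw [hy, T.dualCoeff_Estar hNeg, Finset.sum_eq_single v (fun u _ hu => by simp [hu])
      (by simp), Pi.single_eq_same, mul_one]
  have h3 : 0 ≤ n v := le_max_right _ _
  have h4 : ∑ u, n u * T.dualCoeff y u ≤
      -∑ u, n u * (-T.euler u * n u - T.graph.nbrSum n u) := by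
    rw [← Finset.sum_neg_distrib]
    refine Finset.sum_le_sum fun u _ => ?_
    have hnu : 0 ≤ n u := le_max_right _ _
    have h5 : n u * y u = -(n u * n u) := by
      rcases le_total (-y u) 0 with h | h
      · have : n u = 0 := max_eq_right h
        simp [this]
      · have : n u = -y u := max_eq_left h
        rw [this]; ring
    have h6 : -T.graph.nbrSum n u ≤ T.graph.nbrSum y u := by
      rw [SimpleGraph.nbrSum, SimpleGraph.nbrSum, ← Finset.sum_neg_distrib]
      refine Finset.sum_le_sum fun z _ => ?_
      split_ifs
      · exact neg_le.1 (le_max_left _ _)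
      · simp
    have h7 := mul_le_mul_of_nonneg_left h6 hnu
    rw [dualCoeff]
    calc n u * (-T.euler u * y u - T.graph.nbrSum y u)
        = -T.euler u * (n u * y u) - n u * T.graph.nbrSum y u := by ring
      _ ≤ -T.euler u * -(n u * n u) - n u * -T.graph.nbrSum n u := by rw [h5]; linarith
      _ = _ := by ring
  linarith

/-- The coordinates of the elements `E*_v` are positive. -/
theorem Estar_pos (hG : T.graph.Connected) (hNeg : T.IsNegDef) (v u : V) : 0 < T.Estar v u := by
  classical
  refine (T.Estar_nonneg hNeg v u).lt_of_ne' fun h0 => ?_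
  -- At a zero of `E*_v` the dual coordinate is minus a sum of nonnegative neighbouring values, yet
  -- it is nonnegative.
  have hstep : ∀ a b, T.graph.Adj a b → T.Estar v a = 0 → T.Estar v b = 0 := by
    intro a b hab ha
    have h1 := congrFun (T.dualCoeff_Estar hNeg v) a
    rw [dualCoeff, ha, mul_zero, zero_sub] at h1
    have h2 : 0 ≤ (Pi.single v 1 : V → ℚ) a := by
      by_cases hav : a = v
      · subst hav; simp
      · simp [hav]
    have h3 : (if T.graph.Adj a b then T.Estar v b else 0) ≤ T.graph.nbrSum (T.Estar v) a := by
      rw [SimpleGraph.nbrSum]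
      convert Finset.single_le_sum (f := fun y => if T.graph.Adj a y then T.Estar v y else 0)
        (fun y _ => ?_) (Finset.mem_univ b)
      split_ifs
      · exact T.Estar_nonneg hNeg v y
      · rfl
    rw [if_pos hab] at h3
    exact le_antisymm (by linarith) (T.Estar_nonneg hNeg v b)
  have hall : ∀ b, T.Estar v b = 0 := by
    intro b
    obtain ⟨p⟩ := hG.preconnected u b
    induction p with
    | nil => exact h0
    | cons hab _ ih => exact ih (hstep _ _ hab h0)
  have h1 := congrFun (T.dualCoeff_Estar hNeg v) v
  rw [Pi.single_eq_same, show T.Estar v = 0 from funext hall] at h1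
  simp [dualCoeff, SimpleGraph.nbrSum] at h1

/-- The coefficient `z(x)` as a product over the vertices. -/
theorem z_eq_prod (hNeg : T.IsNegDef) (x : V → ℚ) (b : V → ℤ)
    (hb : T.dualCoeff x = fun v => (b v : ℚ)) :
    T.z x = ∏ v, (oneSubZPow ((T.valency v : ℤ) - 2)).coeff (b v) := by
  have hiff : ∀ c : V →₀ ℕ, ∑ v, c v • T.Estar v = x ↔ ∀ v, (c v : ℤ) = b v := by
    intro c
    rw [T.sum_nsmul_Estar_eq_iff hNeg, hb, funext_iff]
    exact forall_congr' fun v => ⟨fun h => by exact_mod_cast h.symm, fun h => by rw [← h]; simp⟩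
  rw [z]
  simp only [hiff]
  by_cases hpos : ∀ v, 0 ≤ b v
  · have hc : ∀ c : V →₀ ℕ, (∀ v, (c v : ℤ) = b v) ↔
        c = Finsupp.equivFunOnFinite.symm fun v => (b v).toNat := by
      intro c
      rw [Finsupp.ext_iff]
      refine forall_congr' fun v => ?_
      have := hpos v
      simp only [Finsupp.equivFunOnFinite_symm_apply_apply]
      lia
    simp only [hc]
    rw [finsum_eq_single _ (Finsupp.equivFunOnFinite.symm fun v => (b v).toNat)]
    · rw [finsum_eq_if, if_pos rfl, coeff_poincareSeries]
      refine Finset.prod_congr rfl fun v _ => ?_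
      simp [hpos v]
    · intro c hc
      simp [hc]
  · push Not at hpos
    obtain ⟨v, hv⟩ := hpos
    rw [Finset.prod_eq_zero (Finset.mem_univ v) (coeff_oneSubZPow_of_neg _ hv)]
    refine finsum_eq_zero_of_forall_eq_zero fun c => ?_
    rw [finsum_eq_if, if_neg]
    intro h
    have := h v
    lia

/-- Only finitely many elements with a bounded coordinate have a non-zero coefficient. -/
theorem finite_z_ne_zero_lt (hG : T.graph.Connected) (hNeg : T.IsNegDef) (u : V) (c : ℚ) :
    {x : V → ℚ | T.z x ≠ 0 ∧ x u < c}.Finite := by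
  have hfin : (Set.univ.pi fun v => Set.Iic ⌈c / T.Estar v u⌉₊ : Set (V → ℕ)).Finite :=
    Set.Finite.pi fun v => Set.finite_Iic _
  refine (hfin.image fun b => ∑ v, b v • T.Estar v).subset ?_
  rintro x ⟨hz, hx⟩
  obtain ⟨b, hb⟩ : ∃ b : V →₀ ℕ, ∑ v, b v • T.Estar v = x := by
    by_contra! h
    refine hz (finsum_eq_zero_of_forall_eq_zero fun b => ?_)
    rw [finsum_eq_if, if_neg (h b)]
  refine ⟨b, fun v _ => ?_, hb⟩
  -- All summands of the `u`-coordinate are nonnegative, so each `b v` is bounded.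
  have h1 : (b v : ℚ) * T.Estar v u ≤ x u := by
    rw [← hb, Finset.sum_apply]
    refine le_trans (by simp) (Finset.single_le_sum (f := fun v => (b v • T.Estar v) u)
      (fun y _ => ?_) (Finset.mem_univ v))
    simpa using mul_nonneg (Nat.cast_nonneg _) (T.Estar_nonneg hNeg y u)
  have h2 : (b v : ℚ) ≤ c / T.Estar v u := by
    rw [le_div_iff₀ (T.Estar_pos hG hNeg v u)]
    linarith
  exact_mod_cast h2.trans (Nat.le_ceil _)

theorem mem_latticeL_iff (x : V → ℚ) :
    x ∈ T.latticeL ↔ ∃ m : V → ℤ, x = fun v => (m v : ℚ) := by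
  rw [latticeL, Submodule.mem_span_range_iff_exists_fun]
  refine exists_congr fun m => ?_
  have : ∑ v, m v • T.E v = fun v => (m v : ℚ) := by
    ext u
    rw [Finset.sum_apply, Finset.sum_eq_single u]
    · simp [E]
    · intro v _ hv
      simp [E, hv.symm]
    · simp
  rw [this, eq_comm]

theorem dualCoeff_add (x y : V → ℚ) : T.dualCoeff (x + y) = T.dualCoeff x + T.dualCoeff y := by
  have h := T.intersectionMatrix_mulVec (x + y)
  rw [Matrix.mulVec_add, intersectionMatrix_mulVec, intersectionMatrix_mulVec] at h
  rw [← neg_inj, ← h, neg_add]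

theorem latticeL_le_latticeL' : T.latticeL ≤ T.latticeL' := by
  intro x hx y hy
  obtain ⟨m, rfl⟩ := (T.mem_latticeL_iff x).1 hx
  obtain ⟨k, rfl⟩ := (T.mem_latticeL_iff y).1 hy
  rw [Submodule.mem_one]
  refine ⟨-∑ v, m v * (-T.euler v * k v - T.graph.nbrSum k v), ?_⟩
  rw [form, Matrix.toBilin'_apply', intersectionMatrix_mulVec, dualCoeff_intCast]
  simp only [eq_intCast, dotProduct, Pi.neg_apply, mul_neg, Finset.sum_neg_distrib]
  push_cast
  rfl

theorem cls_eq_cls_iff (x y : T.latticeL') :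
    T.cls x = T.cls y ↔ ∃ m : V → ℤ, (x : V → ℚ) = (y : V → ℚ) + fun v => (m v : ℚ) := by
  rw [cls, cls, Submodule.Quotient.eq, Submodule.submoduleOf, Submodule.mem_comap,
    mem_latticeL_iff]
  refine exists_congr fun m => ?_
  simp [sub_eq_iff_eq_add, add_comm]

theorem exists_nat_of_mem_lipmanCone (s : V → ℚ) (hs : s ∈ T.lipmanCone) :
    ∃ n : V → ℕ, s = ∑ v, n v • T.Estar v := by
  induction hs using AddSubmonoid.closure_induction with
  | mem x hx =>
    obtain ⟨v, rfl⟩ := hx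
    exact ⟨Pi.single v 1, by
      rw [Finset.sum_eq_single v (fun y _ hy => by simp [hy]) (by simp)]; simp⟩
  | zero => exact ⟨0, by simp⟩
  | add x y _ _ hx hy =>
    obtain ⟨n, rfl⟩ := hx
    obtain ⟨k, rfl⟩ := hy
    exact ⟨n + k, by simp [add_smul, Finset.sum_add_distrib]⟩

end PlumbingGraph

/-! ### Reduction of the counting functions to vertex products. -/

namespace PlumbingGraph

open HahnSeries

variable {V : Type*} [Fintype V] [DecidableEq V] (T : PlumbingGraph V)

open Classical in
/-- The system of Laurent series whose vertex products are the coefficients `z`, restricted to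
the region given by `I` and `w`. -/
noncomputable def regionSeries (β : V → ℤ) (I : Set V) (w v : V) (s : ℤ) : HahnSeries ℤ ℤ :=
  if (v ∈ I ∧ 0 ≤ s) ∨ (v = w ∧ s < 0) then 0
  else single (-(β v - T.euler v * s)) 1 * oneSubZPow ((T.valency v : ℤ) - 2)

-- The bound `β v ≥ δ_v - 2` is exactly the degree bound at unconstrained vertices. At `v ∈ I` the
-- series is `0` for `s ≥ 0`, so any positive `τ` would do there.
open Classical in
theorem isAdmissible_regionSeries (hNeg : T.IsNegDef) (β : V → ℤ)
    (hβ : ∀ v, (T.valency v : ℤ) - 2 ≤ β v) {I : Set V} {w : V} (hw : w ∉ I) {br : V → Bool}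
    (hbr : ∀ x y, T.graph.Adj x y → x ≠ w → y ≠ w → br x = br y)
    {x y : V} (hx : x ∈ I) (hy : y ∈ I) (hbx : br x = true) (hby : br y = false) :
    T.graph.IsAdmissible w br (fun v => -T.euler v) (fun v => if v ∈ I then 2 else 0)
      (T.regionSeries β I w) where
  posDef x hx := T.sum_mul_dualCoeff_pos hNeg x hx
  eq_zero s hs := by simp [regionSeries, hs]
  order v := by
    refine ⟨β v, fun s n hn => ?_⟩
    rw [regionSeries] at hn
    split_ifs at hn
    · simp at hn
    · rw [coeff_single_mul, one_mul] at hn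
      have h : 0 ≤ n - -(β v - T.euler v * s) := by
        by_contra! h
        exact hn (coeff_oneSubZPow_of_neg _ h)
      have : ((0 : ℤ) : ℚ) ≤ (n - -(β v - T.euler v * s) : ℤ) := by exact_mod_cast h
      push_cast at this
      linarith
  type v s hs := by
    rw [← valency_eq_nbrSum]
    by_cases hv : v ∈ I
    · have h0 : T.regionSeries β I w v s = 0 := by simp [regionSeries, hv, hs]
      -- As `P = 0`, any `D` below `B` is allowed.
      let B : ℚ := 2 - (T.valency v : ℚ) - -T.euler v * s
      refine ⟨0, ⌊B⌋ - 1, by simp [h0], by simpa [hv] using vanishingType_zero two_ne_zero _,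
        ?_, fun _ => ?_⟩
      · push_cast
        linarith [Int.floor_le B]
      · push_cast
        linarith [Int.floor_le B]
    · have h0 : T.regionSeries β I w v s =
          single (-(β v - T.euler v * s)) 1 * oneSubZPow ((T.valency v : ℤ) - 2) := by
        rw [regionSeries, if_neg]
        simp [hv, hs]
      refine ⟨_, _, ?_, by rw [if_neg hv]; exact vanishingType_single (-(β v - T.euler v * s)),
        ?_, by simp [hv]⟩
      · rw [h0, mul_left_comm, oneSub_sq_mul_oneSubZPow, mul_comm]
      · have : ((T.valency v : ℤ) - 2 : ℚ) ≤ β v := by exact_mod_cast hβ v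
        push_cast at this ⊢
        linarith
  branch := hbr
  count := by
    have hx' : ∃ x, x ≠ w ∧ br x = true ∧ (if x ∈ I then 2 else 0) ≠ 0 :=
      ⟨x, fun h => hw (h ▸ hx), hbx, by simp [hx]⟩
    have hy' : ∃ x, x ≠ w ∧ br x = false ∧ (if x ∈ I then 2 else 0) ≠ 0 :=
      ⟨y, fun h => hw (h ▸ hy), hby, by simp [hy]⟩
    rw [if_pos hx', if_pos hy']
    lia

variable {T}

open Classical in
theorem vertexProduct_regionSeries (hNeg : T.IsNegDef) {β : V → ℤ} {x₀ : V → ℚ}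
    (hx₀ : T.dualCoeff x₀ = fun v => (β v : ℚ)) (I : Set V) (w : V) (m : V → ℤ) :
    T.graph.vertexProduct (T.regionSeries β I w) m =
      if (∀ v ∈ I, m v < 0) ∧ 0 ≤ m w then T.z (x₀ + fun v => (m v : ℚ)) else 0 := by
  split_ifs with h
  · have hb : T.dualCoeff (x₀ + fun v => (m v : ℚ)) =
        fun v => ((β v - T.euler v * m v - T.graph.nbrSum m v : ℤ) : ℚ) := by
      rw [dualCoeff_add, hx₀, dualCoeff_intCast]
      ext v
      simp only [Pi.add_apply]
      push_cast
      ring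
    rw [T.z_eq_prod hNeg _ _ hb, SimpleGraph.vertexProduct]
    refine Finset.prod_congr rfl fun v _ => ?_
    rw [regionSeries, if_neg, coeff_single_mul, one_mul]
    · congr 1
      ring
    · rintro (⟨hv, h0⟩ | ⟨rfl, h0⟩)
      · exact absurd (h.1 v hv) (by lia)
      · exact absurd h.2 (by lia)
  · rw [not_and_or] at h
    push Not at h
    obtain ⟨v, hv⟩ : ∃ v, (v ∈ I ∧ 0 ≤ m v) ∨ (v = w ∧ m v < 0) := by
      rcases h with ⟨v, hv, h0⟩ | h
      · exact ⟨v, Or.inl ⟨hv, h0⟩⟩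
      · exact ⟨w, Or.inr ⟨rfl, h⟩⟩
    exact Finset.prod_eq_zero (Finset.mem_univ v) (by rw [regionSeries, if_pos hv]; rfl)

theorem finite_modifiedRegion_z_ne_zero (hG : T.graph.Connected) (hNeg : T.IsNegDef) (h : T.H)
    {J : Set V} (hJ : J.Nonempty) (x : T.latticeL') :
    {l' ∈ T.modifiedRegion h J x | T.z (l' : V → ℚ) ≠ 0}.Finite := by
  obtain ⟨u, hu⟩ := hJ
  refine ((T.finite_z_ne_zero_lt hG hNeg u ((x : V → ℚ) u)).preimage
    Subtype.val_injective.injOn).subset ?_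
  rintro l' ⟨⟨-, hl⟩, hz⟩
  exact ⟨hz, hl u hu⟩

theorem modifiedRegion_anti (h : T.H) {J K : Set V} (hJK : J ⊆ K) (x : T.latticeL') :
    T.modifiedRegion h K x ⊆ T.modifiedRegion h J x :=
  fun _ hl => ⟨hl.1, fun v hv => hl.2 v (hJK hv)⟩

/-- Adding a vertex that separates two elements of `J` does not change the modified counting
function. -/
theorem q_insert_eq (hTree : T.graph.IsTree) (hNeg : T.IsNegDef) (x₀ : T.latticeL')
    {β : V → ℤ} (hx₀ : T.dualCoeff x₀ = fun v => (β v : ℚ))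
    (hβ : ∀ v, (T.valency v : ℤ) - 2 ≤ β v) {J : Set V} {w : V} (hw : w ∉ J) {br : V → Bool}
    (hbr : ∀ x y, T.graph.Adj x y → x ≠ w → y ≠ w → br x = br y)
    {x y : V} (hx : x ∈ J) (hy : y ∈ J) (hbx : br x = true) (hby : br y = false) :
    T.q (T.cls x₀) (insert w J) x₀ = T.q (T.cls x₀) J x₀ := by
  classical
  have hfin := finite_modifiedRegion_z_ne_zero hTree.1 hNeg (T.cls x₀) ⟨x, hx⟩ x₀
  have hanti := modifiedRegion_anti (T.cls x₀) (Set.subset_insert w J) x₀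
  rw [q, q, ← finsum_mem_add_sdiff' hanti hfin, left_eq_add]
  let e : (V → ℤ) → T.latticeL' := fun m =>
    x₀ + ⟨fun v => (m v : ℚ), T.latticeL_le_latticeL' ((T.mem_latticeL_iff _).2 ⟨m, rfl⟩)⟩
  have he : ∀ m, (e m : V → ℚ) = (x₀ : V → ℚ) + fun v => (m v : ℚ) := fun _ => rfl
  have he_inj : Function.Injective e := by
    intro m k hmk
    have h1 := congrArg (Subtype.val : T.latticeL' → V → ℚ) hmk
    rw [he, he, add_right_inj] at h1
    ext v
    exact_mod_cast congrFun h1 v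
  have hbij : Set.BijOn e {m | (∀ v ∈ J, m v < 0) ∧ 0 ≤ m w}
      (T.modifiedRegion (T.cls x₀) J x₀ \ T.modifiedRegion (T.cls x₀) (insert w J) x₀) := by
    refine ⟨?_, he_inj.injOn, ?_⟩
    · rintro m ⟨hm, hmw⟩
      refine ⟨⟨(T.cls_eq_cls_iff _ _).2 ⟨m, he m⟩, fun v hv => ?_⟩, fun h => ?_⟩
      · rw [he, Pi.add_apply, add_lt_iff_neg_left]
        exact_mod_cast hm v hv
      · have := h.2 w (Set.mem_insert w J)
        rw [he, Pi.add_apply, add_lt_iff_neg_left] at this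
        have : m w < 0 := by exact_mod_cast this
        lia
    · rintro l ⟨⟨hl, hlt⟩, hnot⟩
      obtain ⟨m, hm⟩ := (T.cls_eq_cls_iff _ _).1 hl
      have hJ : ∀ v ∈ J, m v < 0 := by
        intro v hv
        have := hlt v hv
        rw [hm, Pi.add_apply, add_lt_iff_neg_left] at this
        exact_mod_cast this
      refine ⟨m, ⟨hJ, ?_⟩, Subtype.ext (by rw [he, hm])⟩
      by_contra! hneg
      refine hnot ⟨hl, fun v hv => ?_⟩
      rcases Set.mem_insert_iff.1 hv with rfl | hv
      · rw [hm, Pi.add_apply, add_lt_iff_neg_left]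
        exact_mod_cast hneg
      · exact hlt v hv
  have hprod := vertexProduct_regionSeries hNeg hx₀ J w
  have hzero := (T.isAdmissible_regionSeries hNeg β hβ hw hbr hx hy hbx
    hby).finsum_vertexProduct_eq_zero hTree ((hfin.preimage he_inj.injOn).subset fun m hm => by
      rw [Function.mem_support, hprod] at hm
      have hm' : (∀ v ∈ J, m v < 0) ∧ 0 ≤ m w := by
        by_contra h
        exact hm (if_neg h)
      rw [if_pos hm'] at hm
      exact ⟨(hbij.mapsTo hm').1, hm⟩)
  rw [← finsum_mem_eq_of_bijOn (f := fun m => T.z (e m)) e hbij fun m _ => rfl,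
    finsum_mem_def]
  refine Eq.trans (finsum_congr fun m => ?_) hzero
  rw [hprod, Set.indicator_apply]
  simp only [he, Set.mem_ofPred_eq]

end PlumbingGraph

/-! ### Conclusion. -/

theorem mainTheorem5 {V : Type*} [Fintype V] [DecidableEq V] (T : PlumbingGraph V)
    (hTree : T.graph.IsTree) (hNeg : T.IsNegDef)
    (I Ibar : Set V) (hI : I.Nonempty) (hIbar : T.IsClosure I Ibar)
    (h : T.H) (l₀ : T.latticeL') (hl₀ : T.cls l₀ = h)
    (hcone : ∃ s ∈ T.lipmanCone,
      (l₀ : V → ℚ) = (∑ v, ((T.valency v : ℤ) - 2) • T.Estar v) + s) :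
    {l' ∈ T.modifiedRegion h I l₀ | T.z (l' : V → ℚ) ≠ 0}.Finite ∧
    {l' ∈ T.modifiedRegion h Ibar l₀ | T.z (l' : V → ℚ) ≠ 0}.Finite ∧
    T.q h I l₀ = T.q h Ibar l₀ := by
  classical
  have hsub := hIbar.prop.1
  refine ⟨PlumbingGraph.finite_modifiedRegion_z_ne_zero hTree.1 hNeg h hI l₀,
    PlumbingGraph.finite_modifiedRegion_z_ne_zero hTree.1 hNeg h (hI.mono hsub) l₀, ?_⟩
  subst hl₀
  obtain ⟨s, hs, hl₀⟩ := hcone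
  obtain ⟨n, rfl⟩ := T.exists_nat_of_mem_lipmanCone s hs
  have hdual : T.dualCoeff l₀ = fun v => (((T.valency v : ℤ) - 2 + n v : ℤ) : ℚ) := by
    rw [← T.dualCoeff_sum_smul_Estar hNeg
      (fun v => (((T.valency v : ℤ) - 2 + n v : ℤ) : ℚ)), hl₀, ← Finset.sum_add_distrib]
    congr 1
    refine Finset.sum_congr rfl fun v _ => ?_
    rw [Int.cast_smul_eq_zsmul, add_smul, natCast_zsmul]
  -- The separated pair is found in `I` itself, so it stays available as `K` grows.
  have key : ∀ K : Finset V, (K : Set V) ⊆ Ibar →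
      T.q (T.cls l₀) (I ∪ K) l₀ = T.q (T.cls l₀) I l₀ := by
    intro K
    induction K using Finset.induction_on with
    | empty => simp
    | insert w K _ ih =>
      intro hK
      rw [Finset.coe_insert, Set.insert_subset_iff] at hK
      rw [Finset.coe_insert, Set.union_insert, ← ih hK.2]
      by_cases hw : w ∈ I ∪ (K : Set V)
      · rw [Set.insert_eq_of_mem hw]
      · obtain ⟨br, hbr, x, hx, y, hy, hbx, hby⟩ := hIbar.exists_separation hTree hI hK.1
          (fun h => hw (Or.inl h))
        exact PlumbingGraph.q_insert_eq hTree hNeg l₀ hdual (fun v => by simp) hw hbr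
          (Or.inl hx) (Or.inl hy) hbx hby
  have := key Ibar.toFinset (by simp)
  rw [Set.coe_toFinset, Set.union_eq_right.2 hsub] at this
  exact this.symm
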